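/- Fix a denumerable set $\mathsf{Atprop}$ of propositional variables $p$. **The logics.** $\mathcal L$-formulas are $A ::= p \mid \top \mid \bot \mid \neg A \mid A\wedge A \mid A\vee A$. Semi De Morgan logic $\mathsf{SM}$ has the axioms (for all $A,B,C$) $$\bot\vdash A,\quad A\vdash\top,\quad \neg\top\vdash\bot,\quad \top\vdash\neg\bot,\quad A\vdash A,\quad A\wedge B\vdash A,\quad A\wedge B\vdash B,\quad A\vdash A\vee B,\quad B\vdash A\vee B,$$ $$\neg A\vdash\neg\neg\neg A,\quad \neg\neg\neg A\vdash\neg A,\quad \neg A\wedge\neg B\vdash\neg(A\vee B),\quad \neg\neg A\wedge\neg\neg B\vdash\neg\neg(A\wedge B),\quad A\wedge(B\vee C)\vdash(A\wedge B)\vee(A\wedge C)$$ and the rules: from $A\vdash B$ and $B\vdash C$ infer $A\vdash C$; from $A\vdash B$ and $A\vdash C$ infer $A\vdash B\wedge C$; from $A\vdash B$ and $C\vdash B$ infer $A\vee C\vdash B$; from $A\vdash B$ infer $\neg B\vdash\neg A$. The logics $\mathsf{LQM}$, $\mathsf{UQM}$, $\mathsf{DP}$, $\mathsf{AP}$, $\mathsf{WS}$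 extend $\mathsf{SM}$ by, respectively, the axiom $A\vdash\neg\neg A$; $\neg\neg A\vdash A$; $\neg A\wedge\neg\neg A\vdash\bot$; $A\wedge\neg A\vdash\bot$; $\top\vdash\neg A\vee\neg\neg A$. Write $A\vdash_{\mathsf L}B$ if $A\vdash B$ is derivable in $\mathsf L$. **The multi-type language.** Formulas of types $\mathsf{DL}$ ($A$) and $\mathsf K$ ($\alpha$): $$A ::= p\mid\Box\alpha\mid\top\mid\bot\mid A\wedge A\mid A\vee A,\qquad \alpha ::= \circ A\mid 1\mid 0\mid{\sim}\alpha\mid\alpha\cup\alpha\mid\alpha\cap\alpha .$$ The translation $(\cdot)^\tau$ from $\mathcal L$-formulas to formulas of type $\mathsf{DL}$ fixes variables, $\top$, $\bot$, commutes with $\wedge$, $\vee$, and $(\neg A)^\tau=\Box{\sim}\circ A^\tau$. Structures of types $\mathsf{DL}$ ($X,Y,Z,W$) and $\mathsf K$ ($\Gamma,\Delta,\Theta,\Pi$): $$X ::= A\mid\hat\top\mid\check\bot\mid\check\Box\Gamma\mid\hat\bullet_\ell\Gamma\mid\check\bullet_r\Gamma\mid X\,\hat\wedge\,X\mid X\,\check\vee\,X\mid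 X\,\hat{>}\,X\mid X\,\check\to\,X,$$ $$\Gamma ::= \alpha\mid\hat1\mid\check0\mid\tilde\circ X\mid\hat\blacklozenge X\mid\tilde*\Gamma\mid\Gamma\,\hat\cap\,\Gamma\mid\Gamma\,\check\cup\,\Gamma\mid\Gamma\,\hat\supset\,\Gamma\mid\Gamma\,\check\to\,\Gamma .$$ Sequents $S\vdash T$ have both sides of the same type. **The display calculi.** $S/S'$ denotes the rule inferring $S'$ from $S$, and $S/\!/S'$ denotes both $S/S'$ and $S'/S$. The calculus $\mathrm{D.SM}$ consists of the following. * Identity $p\vdash p$; cuts: from $X\vdash A$ and $A\vdash Y$ infer $X\vdash Y$; from $\Gamma\vdash\alpha$ and $\alpha\vdash\Delta$ infer $\Gamma\vdash\Delta$. * Display rules: $X\hat\wedge Y\vdash Z\,/\!/\,Y\vdash X\check\to Z$; $X\vdash Y\check\vee Z\,/\!/\,Y\hat{>}X\vdash Z$; $\Gamma\hat\cap\Delta\vdash\Theta\,/\!/\,\Delta\vdash\Gamma\check\to\Theta$; $\Gamma\vdash\Delta\check\cup\Theta\,/\!/\,\Delta\hat\supset\Gamma\vdash\Theta$; $\tilde*\Gamma\vdash\Delta\,/\!/\,\tilde*\Delta\vdash\Gamma$;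 $\Gamma\vdash\tilde*\Delta\,/\!/\,\Delta\vdash\tilde*\Gamma$; $X\vdash\check\Box\Gamma\,/\!/\,\hat\blacklozenge X\vdash\Gamma$; $\tilde\circ X\vdash\Gamma\,/\!/\,X\vdash\check\bullet_r\Gamma$; $\Gamma\vdash\tilde\circ X\,/\!/\,\hat\bullet_\ell\Gamma\vdash X$. * Structural rules of type $\mathsf{DL}$: $X\vdash Y\,/\!/\,X\hat\wedge\hat\top\vdash Y$; $X\vdash Y\,/\!/\,X\vdash Y\check\vee\check\bot$; $X\hat\wedge Y\vdash Z\,/\,Y\hat\wedge X\vdash Z$; $X\vdash Y\check\vee Z\,/\,X\vdash Z\check\vee Y$; $(X\hat\wedge Y)\hat\wedge Z\vdash W\,/\!/\,X\hat\wedge(Y\hat\wedge Z)\vdash W$; $X\vdash(Y\check\vee Z)\check\vee W\,/\!/\,X\vdash Y\check\vee(Z\check\vee W)$; $X\vdash Y\,/\,X\hat\wedge Z\vdash Y$; $X\vdash Y\,/\,X\vdash Y\check\vee Z$; $X\hat\wedge X\vdash Y\,/\,X\vdash Y$; $X\vdash Y\check\vee Y\,/\,X\vdash Y$. * Structural rules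 of type $\mathsf K$: the same rules with $\hat\cap,\check\cup,\hat1,\check0$ in place of $\hat\wedge,\check\vee,\hat\top,\check\bot$ and structures of type $\mathsf K$; and $\Gamma\vdash\Delta\,/\!/\,\tilde*\Delta\vdash\tilde*\Gamma$. * Multi-type structural rules: $X\vdash Y\,/\,\tilde\circ X\vdash\tilde\circ Y$; $\hat\bullet_\ell\Gamma\vdash\check\bullet_r\Delta\,/\,\Gamma\vdash\Delta$; $\hat1\vdash\Gamma\,/\,\hat\blacklozenge\hat\top\vdash\Gamma$; $X\vdash\check\Box\check0\,/\,X\vdash\check\bot$; $\Gamma\vdash\tilde\circ\check\Box\Delta\,/\!/\,\Gamma\vdash\Delta$. * Operational rules of type $\mathsf{DL}$: $\hat\top\vdash X\,/\,\top\vdash X$; $\hat\top\vdash\top$; $\bot\vdash\check\bot$; $X\vdash\check\bot\,/\,X\vdash\bot$; $A\hat\wedge B\vdash X\,/\,A\wedge B\vdash X$; from $X\vdash A$ and $Y\vdash B$ infer $X\hat\wedge Y\vdash A\wedge B$; from $A\vdash X$ and $B\vdash Y$ infer $A\vee B\vdash X\check\vee Y$; $X\vdash A\check\vee B\,/\,X\vdash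 A\vee B$. * Operational rules of type $\mathsf K$: the same rules with $1,0,\cap,\cup$ and their structural counterparts; and $\tilde*\alpha\vdash\Gamma\,/\,{\sim}\alpha\vdash\Gamma$; $\Gamma\vdash\tilde*\alpha\,/\,\Gamma\vdash{\sim}\alpha$. * Multi-type operational rules: $\tilde\circ A\vdash\Gamma\,/\,\circ A\vdash\Gamma$; $\Gamma\vdash\tilde\circ A\,/\,\Gamma\vdash\circ A$; $\alpha\vdash\Gamma\,/\,\Box\alpha\vdash\check\Box\Gamma$; $X\vdash\check\Box\alpha\,/\,X\vdash\Box\alpha$. The other calculi are: $\mathrm{D.LQM}$ = $\mathrm{D.SM}$ plus $X\vdash Y\,/\,X\vdash\check\Box\tilde\circ Y$; $\mathrm{D.UQM}$ = $\mathrm{D.SM}$ plus $\hat\bullet_\ell\hat\blacklozenge X\vdash Y\,/\,X\vdash Y$; $\mathrm{D.DP}$ = $\mathrm{D.SM}$ plus $\Gamma\hat\cap\Delta\vdash\Theta\,/\!/\,\Delta\vdash\tilde*\Gamma\,\check\cup\,\Theta$; $\mathrm{D.AP}$ = $\mathrm{D.DP}$ plus $X\vdash\check\Box\tilde*\tilde\circ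 Y\,/\,X\hat\wedge Y\vdash\check\bot$; $\mathrm{D.WS}$ = $\mathrm{D.DP}$ plus $\hat\blacklozenge X\vdash\Delta\,/\,\hat\blacklozenge\bigl(\check\Box\tilde*\tilde\circ X\,\hat{>}\,\hat\top\bigr)\vdash\Delta$. **Theorem (Conservativity).** For each logic $\mathsf L\in\{\mathsf{SM},\mathsf{LQM},\mathsf{UQM},\mathsf{DP},\mathsf{AP},\mathsf{WS}\}$ and all $\mathcal L$-formulas $A,B$: if $A^\tau\vdash B^\tau$ is derivable in $\mathrm{D.L}$, then $A\vdash_{\mathsf L}B$. -/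

import Mathlib

/-! ## The single-type logics -/

/-- Formulas of the language of semi De Morgan logic over the propositional variables `P`. -/
inductive SMFormula (P : Type*) : Type _
  | var (p : P) : SMFormula P
  | top : SMFormula P
  | bot : SMFormula P
  | neg (A : SMFormula P) : SMFormula P
  | and (A B : SMFormula P) : SMFormula P
  | or (A B : SMFormula P) : SMFormula P

/-- The six logics: semi De Morgan logic, lower quasi De Morgan logic, upper quasi De Morgan logic,
demi pseudo-complemented lattice logic, almost pseudo-complemented lattice logic,
weak Stone logic. -/
inductive SMLogic : Type
  | SM
  | LQM
  | UQM
  | DP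
  | AP
  | WS

/-- `SMLogic.Provable L A B`: the sequent `A ⊢ B` is derivable in the logic `L`. -/
inductive SMLogic.Provable {P : Type*} (L : SMLogic) : SMFormula P → SMFormula P → Prop
  -- axioms of semi De Morgan logic
  | bot_left (A : SMFormula P) : Provable L .bot A
  | top_right (A : SMFormula P) : Provable L A .top
  | neg_top : Provable L (.neg .top) .bot
  | neg_bot : Provable L .top (.neg .bot)
  | refl (A : SMFormula P) : Provable L A A
  | and_left₁ (A B : SMFormula P) : Provable L (.and A B) A
  | and_left₂ (A B : SMFormula P) : Provable L (.and A B) B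
  | or_right₁ (A B : SMFormula P) : Provable L A (.or A B)
  | or_right₂ (A B : SMFormula P) : Provable L B (.or A B)
  | neg_to_triple (A : SMFormula P) : Provable L (.neg A) (.neg (.neg (.neg A)))
  | triple_to_neg (A : SMFormula P) : Provable L (.neg (.neg (.neg A))) (.neg A)
  | neg_and_neg (A B : SMFormula P) :
      Provable L (.and (.neg A) (.neg B)) (.neg (.or A B))
  | double_neg_and (A B : SMFormula P) :
      Provable L (.and (.neg (.neg A)) (.neg (.neg B))) (.neg (.neg (.and A B)))
  | distrib (A B C : SMFormula P) :
      Provable L (.and A (.or B C)) (.or (.and A B) (.and A C))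
  -- rules of semi De Morgan logic
  | trans {A B C : SMFormula P} : Provable L A B → Provable L B C → Provable L A C
  | and_right {A B C : SMFormula P} :
      Provable L A B → Provable L A C → Provable L A (.and B C)
  | or_left {A B C : SMFormula P} :
      Provable L A B → Provable L C B → Provable L (.or A C) B
  | contra {A B : SMFormula P} : Provable L A B → Provable L (.neg B) (.neg A)
  -- characteristic axioms of the extensions
  | ax_LQM (hL : L = .LQM) (A : SMFormula P) : Provable L A (.neg (.neg A))
  | ax_UQM (hL : L = .UQM) (A : SMFormula P) : Provable L (.neg (.neg A)) A
  | ax_DP (hL : L = .DP) (A : SMFormula P) :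
      Provable L (.and (.neg A) (.neg (.neg A))) .bot
  | ax_AP (hL : L = .AP) (A : SMFormula P) : Provable L (.and A (.neg A)) .bot
  | ax_WS (hL : L = .WS) (A : SMFormula P) :
      Provable L .top (.or (.neg A) (.neg (.neg A)))

/-! ## The multi-type language -/

/-- The two types of the multi-type language. -/
inductive MTType : Type
  | DL
  | K

/-- Formulas (operational terms) of the multi-type language, of type `DL` or `K`. -/
inductive MTFormula (P : Type*) : MTType → Type _
  | var (p : P) : MTFormula P .DL
  | box (α : MTFormula P .K) : MTFormula P .DL
  | top : MTFormula P .DL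
  | bot : MTFormula P .DL
  | and (A B : MTFormula P .DL) : MTFormula P .DL
  | or (A B : MTFormula P .DL) : MTFormula P .DL
  | circ (A : MTFormula P .DL) : MTFormula P .K
  | one : MTFormula P .K
  | zero : MTFormula P .K
  | sim (α : MTFormula P .K) : MTFormula P .K
  | cup (α β : MTFormula P .K) : MTFormula P .K
  | cap (α β : MTFormula P .K) : MTFormula P .K

/-- The translation `τ` of single-type formulas into multi-type formulas of type `DL`. -/
def SMFormula.tau {P : Type*} : SMFormula P → MTFormula P .DL
  | .var p => .var p
  | .top => .top
  | .bot => .bot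
  | .neg A => .box (.sim (.circ A.tau))
  | .and A B => .and A.tau B.tau
  | .or A B => .or A.tau B.tau

/-- Structures (structural terms) of the display calculi, of type `DL` or `K`. -/
inductive MTStructure (P : Type*) : MTType → Type _
  /-- a formula, seen as a structure -/
  | form {t : MTType} (A : MTFormula P t) : MTStructure P t
  /-- structural `⊤` -/
  | top : MTStructure P .DL
  /-- structural `⊥` -/
  | bot : MTStructure P .DL
  /-- structural `□` -/
  | box (Γ : MTStructure P .K) : MTStructure P .DL
  /-- structural `•_ℓ`, left adjoint of structural `∘` -/
  | bulL (Γ : MTStructure P .K) : MTStructure P .DL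
  /-- structural `•_r`, right adjoint of structural `∘` -/
  | bulR (Γ : MTStructure P .K) : MTStructure P .DL
  /-- structural `∧` -/
  | and (X Y : MTStructure P .DL) : MTStructure P .DL
  /-- structural `∨` -/
  | or (X Y : MTStructure P .DL) : MTStructure P .DL
  /-- structural co-implication `X >- Y`, left residual of structural `∨` -/
  | coimp (X Y : MTStructure P .DL) : MTStructure P .DL
  /-- structural implication `X → Y`, right residual of structural `∧` -/
  | imp (X Y : MTStructure P .DL) : MTStructure P .DL
  /-- structural `1` -/
  | one : MTStructure P .K
  /-- structural `0` -/
  | zero : MTStructure P .K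
  /-- structural `∘` -/
  | circ (X : MTStructure P .DL) : MTStructure P .K
  /-- structural `◆`, left adjoint of structural `□` -/
  | dia (X : MTStructure P .DL) : MTStructure P .K
  /-- structural `*`, the counterpart of `∼` -/
  | star (Γ : MTStructure P .K) : MTStructure P .K
  /-- structural `∩` -/
  | cap (Γ Δ : MTStructure P .K) : MTStructure P .K
  /-- structural `∪` -/
  | cup (Γ Δ : MTStructure P .K) : MTStructure P .K
  /-- structural co-implication `Γ ⊃- Δ`, left residual of structural `∪` -/
  | kcoimp (Γ Δ : MTStructure P .K) : MTStructure P .K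
  /-- structural implication `Γ -⊃ Δ`, right residual of structural `∩` -/
  | kimp (Γ Δ : MTStructure P .K) : MTStructure P .K

/-! ## The display calculi -/

/-- `DisplayDerivable L X Y`: the sequent `X ⊢ Y` (with both sides of the same type) is derivable in
the display calculus `D.L`. Invertible (double-line) rules give two constructors each, the second
with a primed name. -/
inductive DisplayDerivable {P : Type*} (L : SMLogic) :
    {t : MTType} → MTStructure P t → MTStructure P t → Prop
  -- identity and cut
  | id (p : P) : DisplayDerivable L (.form (.var p)) (.form (.var p))
  | cut_L {X Y : MTStructure P .DL} {A : MTFormula P .DL} :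
      DisplayDerivable L X (.form A) → DisplayDerivable L (.form A) Y → DisplayDerivable L X Y
  | cut_D {Γ Δ : MTStructure P .K} {α : MTFormula P .K} :
      DisplayDerivable L Γ (.form α) → DisplayDerivable L (.form α) Δ → DisplayDerivable L Γ Δ
  -- display rules, type DL
  | res_and {X Y Z : MTStructure P .DL} :
      DisplayDerivable L (.and X Y) Z → DisplayDerivable L Y (.imp X Z)
  | res_and' {X Y Z : MTStructure P .DL} :
      DisplayDerivable L Y (.imp X Z) → DisplayDerivable L (.and X Y) Z
  | res_or {X Y Z : MTStructure P .DL} :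
      DisplayDerivable L X (.or Y Z) → DisplayDerivable L (.coimp Y X) Z
  | res_or' {X Y Z : MTStructure P .DL} :
      DisplayDerivable L (.coimp Y X) Z → DisplayDerivable L X (.or Y Z)
  -- display rules, type K
  | res_cap {Γ Δ Θ : MTStructure P .K} :
      DisplayDerivable L (.cap Γ Δ) Θ → DisplayDerivable L Δ (.kimp Γ Θ)
  | res_cap' {Γ Δ Θ : MTStructure P .K} :
      DisplayDerivable L Δ (.kimp Γ Θ) → DisplayDerivable L (.cap Γ Δ) Θ
  | res_cup {Γ Δ Θ : MTStructure P .K} :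
      DisplayDerivable L Γ (.cup Δ Θ) → DisplayDerivable L (.kcoimp Δ Γ) Θ
  | res_cup' {Γ Δ Θ : MTStructure P .K} :
      DisplayDerivable L (.kcoimp Δ Γ) Θ → DisplayDerivable L Γ (.cup Δ Θ)
  -- each of the next two rules is its own inverse
  | adj_star_left {Γ Δ : MTStructure P .K} :
      DisplayDerivable L (.star Γ) Δ → DisplayDerivable L (.star Δ) Γ
  | adj_star_right {Γ Δ : MTStructure P .K} :
      DisplayDerivable L Γ (.star Δ) → DisplayDerivable L Δ (.star Γ)
  -- multi-type display rules
  | adj_box {X : MTStructure P .DL} {Γ : MTStructure P .K} :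
      DisplayDerivable L X (.box Γ) → DisplayDerivable L (.dia X) Γ
  | adj_box' {X : MTStructure P .DL} {Γ : MTStructure P .K} :
      DisplayDerivable L (.dia X) Γ → DisplayDerivable L X (.box Γ)
  | adj_circ_left {X : MTStructure P .DL} {Γ : MTStructure P .K} :
      DisplayDerivable L (.circ X) Γ → DisplayDerivable L X (.bulR Γ)
  | adj_circ_left' {X : MTStructure P .DL} {Γ : MTStructure P .K} :
      DisplayDerivable L X (.bulR Γ) → DisplayDerivable L (.circ X) Γ
  | adj_circ_right {X : MTStructure P .DL} {Γ : MTStructure P .K} :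
      DisplayDerivable L Γ (.circ X) → DisplayDerivable L (.bulL Γ) X
  | adj_circ_right' {X : MTStructure P .DL} {Γ : MTStructure P .K} :
      DisplayDerivable L (.bulL Γ) X → DisplayDerivable L Γ (.circ X)
  -- structural rules, type DL
  | top_unit {X Y : MTStructure P .DL} :
      DisplayDerivable L X Y → DisplayDerivable L (.and X .top) Y
  | top_unit' {X Y : MTStructure P .DL} :
      DisplayDerivable L (.and X .top) Y → DisplayDerivable L X Y
  | bot_unit {X Y : MTStructure P .DL} :
      DisplayDerivable L X Y → DisplayDerivable L X (.or Y .bot)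
  | bot_unit' {X Y : MTStructure P .DL} :
      DisplayDerivable L X (.or Y .bot) → DisplayDerivable L X Y
  | exch_and {X Y Z : MTStructure P .DL} :
      DisplayDerivable L (.and X Y) Z → DisplayDerivable L (.and Y X) Z
  | exch_or {X Y Z : MTStructure P .DL} :
      DisplayDerivable L X (.or Y Z) → DisplayDerivable L X (.or Z Y)
  | assoc_and {X Y Z W : MTStructure P .DL} :
      DisplayDerivable L (.and (.and X Y) Z) W → DisplayDerivable L (.and X (.and Y Z)) W
  | assoc_and' {X Y Z W : MTStructure P .DL} :
      DisplayDerivable L (.and X (.and Y Z)) W → DisplayDerivable L (.and (.and X Y) Z) W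
  | assoc_or {X Y Z W : MTStructure P .DL} :
      DisplayDerivable L X (.or (.or Y Z) W) → DisplayDerivable L X (.or Y (.or Z W))
  | assoc_or' {X Y Z W : MTStructure P .DL} :
      DisplayDerivable L X (.or Y (.or Z W)) → DisplayDerivable L X (.or (.or Y Z) W)
  | weak_and {X Y : MTStructure P .DL} (Z : MTStructure P .DL) :
      DisplayDerivable L X Y → DisplayDerivable L (.and X Z) Y
  | weak_or {X Y : MTStructure P .DL} (Z : MTStructure P .DL) :
      DisplayDerivable L X Y → DisplayDerivable L X (.or Y Z)
  | contr_and {X Y : MTStructure P .DL} :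
      DisplayDerivable L (.and X X) Y → DisplayDerivable L X Y
  | contr_or {X Y : MTStructure P .DL} :
      DisplayDerivable L X (.or Y Y) → DisplayDerivable L X Y
  -- structural rules, type K
  | one_unit {Γ Δ : MTStructure P .K} :
      DisplayDerivable L Γ Δ → DisplayDerivable L (.cap Γ .one) Δ
  | one_unit' {Γ Δ : MTStructure P .K} :
      DisplayDerivable L (.cap Γ .one) Δ → DisplayDerivable L Γ Δ
  | zero_unit {Γ Δ : MTStructure P .K} :
      DisplayDerivable L Γ Δ → DisplayDerivable L Γ (.cup Δ .zero)
  | zero_unit' {Γ Δ : MTStructure P .K} :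
      DisplayDerivable L Γ (.cup Δ .zero) → DisplayDerivable L Γ Δ
  | exch_cap {Γ Δ Θ : MTStructure P .K} :
      DisplayDerivable L (.cap Γ Δ) Θ → DisplayDerivable L (.cap Δ Γ) Θ
  | exch_cup {Γ Δ Θ : MTStructure P .K} :
      DisplayDerivable L Γ (.cup Δ Θ) → DisplayDerivable L Γ (.cup Θ Δ)
  | assoc_cap {Γ Δ Θ Ξ : MTStructure P .K} :
      DisplayDerivable L (.cap (.cap Γ Δ) Θ) Ξ → DisplayDerivable L (.cap Γ (.cap Δ Θ)) Ξ
  | assoc_cap' {Γ Δ Θ Ξ : MTStructure P .K} :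
      DisplayDerivable L (.cap Γ (.cap Δ Θ)) Ξ → DisplayDerivable L (.cap (.cap Γ Δ) Θ) Ξ
  | assoc_cup {Γ Δ Θ Ξ : MTStructure P .K} :
      DisplayDerivable L Γ (.cup (.cup Δ Θ) Ξ) → DisplayDerivable L Γ (.cup Δ (.cup Θ Ξ))
  | assoc_cup' {Γ Δ Θ Ξ : MTStructure P .K} :
      DisplayDerivable L Γ (.cup Δ (.cup Θ Ξ)) → DisplayDerivable L Γ (.cup (.cup Δ Θ) Ξ)
  | weak_cap {Γ Δ : MTStructure P .K} (Θ : MTStructure P .K) :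
      DisplayDerivable L Γ Δ → DisplayDerivable L (.cap Γ Θ) Δ
  | weak_cup {Γ Δ : MTStructure P .K} (Θ : MTStructure P .K) :
      DisplayDerivable L Γ Δ → DisplayDerivable L Γ (.cup Δ Θ)
  | contr_cap {Γ Δ : MTStructure P .K} :
      DisplayDerivable L (.cap Γ Γ) Δ → DisplayDerivable L Γ Δ
  | contr_cup {Γ Δ : MTStructure P .K} :
      DisplayDerivable L Γ (.cup Δ Δ) → DisplayDerivable L Γ Δ
  | cont {Γ Δ : MTStructure P .K} :
      DisplayDerivable L Γ Δ → DisplayDerivable L (.star Δ) (.star Γ)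
  | cont' {Γ Δ : MTStructure P .K} :
      DisplayDerivable L (.star Δ) (.star Γ) → DisplayDerivable L Γ Δ
  -- multi-type structural rules
  | circ_mono {X Y : MTStructure P .DL} :
      DisplayDerivable L X Y → DisplayDerivable L (.circ X) (.circ Y)
  | bul {Γ Δ : MTStructure P .K} :
      DisplayDerivable L (.bulL Γ) (.bulR Δ) → DisplayDerivable L Γ Δ
  | dia_one {Γ : MTStructure P .K} :
      DisplayDerivable L .one Γ → DisplayDerivable L (.dia .top) Γ
  | box_zero {X : MTStructure P .DL} :
      DisplayDerivable L X (.box .zero) → DisplayDerivable L X .bot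
  | circ_box {Γ Δ : MTStructure P .K} :
      DisplayDerivable L Γ (.circ (.box Δ)) → DisplayDerivable L Γ Δ
  | circ_box' {Γ Δ : MTStructure P .K} :
      DisplayDerivable L Γ Δ → DisplayDerivable L Γ (.circ (.box Δ))
  -- operational rules, type DL
  | top_left {X : MTStructure P .DL} :
      DisplayDerivable L .top X → DisplayDerivable L (.form .top) X
  | top_right : DisplayDerivable L .top (.form .top)
  | bot_left : DisplayDerivable L (.form .bot) .bot
  | bot_right {X : MTStructure P .DL} :
      DisplayDerivable L X .bot → DisplayDerivable L X (.form .bot)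
  | and_left {A B : MTFormula P .DL} {X : MTStructure P .DL} :
      DisplayDerivable L (.and (.form A) (.form B)) X → DisplayDerivable L (.form (.and A B)) X
  | and_right {A B : MTFormula P .DL} {X Y : MTStructure P .DL} :
      DisplayDerivable L X (.form A) → DisplayDerivable L Y (.form B) →
        DisplayDerivable L (.and X Y) (.form (.and A B))
  | or_left {A B : MTFormula P .DL} {X Y : MTStructure P .DL} :
      DisplayDerivable L (.form A) X → DisplayDerivable L (.form B) Y →
        DisplayDerivable L (.form (.or A B)) (.or X Y)
  | or_right {A B : MTFormula P .DL} {X : MTStructure P .DL} :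
      DisplayDerivable L X (.or (.form A) (.form B)) → DisplayDerivable L X (.form (.or A B))
  -- operational rules, type K
  | one_left {Γ : MTStructure P .K} :
      DisplayDerivable L .one Γ → DisplayDerivable L (.form .one) Γ
  | one_right : DisplayDerivable L .one (.form .one)
  | zero_left : DisplayDerivable L (.form .zero) .zero
  | zero_right {Γ : MTStructure P .K} :
      DisplayDerivable L Γ .zero → DisplayDerivable L Γ (.form .zero)
  | cap_left {α β : MTFormula P .K} {Γ : MTStructure P .K} :
      DisplayDerivable L (.cap (.form α) (.form β)) Γ → DisplayDerivable L (.form (.cap α β)) Γ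
  | cap_right {α β : MTFormula P .K} {Γ Δ : MTStructure P .K} :
      DisplayDerivable L Γ (.form α) → DisplayDerivable L Δ (.form β) →
        DisplayDerivable L (.cap Γ Δ) (.form (.cap α β))
  | cup_left {α β : MTFormula P .K} {Γ Δ : MTStructure P .K} :
      DisplayDerivable L (.form α) Γ → DisplayDerivable L (.form β) Δ →
        DisplayDerivable L (.form (.cup α β)) (.cup Γ Δ)
  | cup_right {α β : MTFormula P .K} {Γ : MTStructure P .K} :
      DisplayDerivable L Γ (.cup (.form α) (.form β)) → DisplayDerivable L Γ (.form (.cup α β))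
  | sim_left {α : MTFormula P .K} {Γ : MTStructure P .K} :
      DisplayDerivable L (.star (.form α)) Γ → DisplayDerivable L (.form (.sim α)) Γ
  | sim_right {α : MTFormula P .K} {Γ : MTStructure P .K} :
      DisplayDerivable L Γ (.star (.form α)) → DisplayDerivable L Γ (.form (.sim α))
  -- multi-type operational rules
  | circ_left {A : MTFormula P .DL} {Γ : MTStructure P .K} :
      DisplayDerivable L (.circ (.form A)) Γ → DisplayDerivable L (.form (.circ A)) Γ
  | circ_right {A : MTFormula P .DL} {Γ : MTStructure P .K} :
      DisplayDerivable L Γ (.circ (.form A)) → DisplayDerivable L Γ (.form (.circ A))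
  | box_left {α : MTFormula P .K} {Γ : MTStructure P .K} :
      DisplayDerivable L (.form α) Γ → DisplayDerivable L (.form (.box α)) (.box Γ)
  | box_right {α : MTFormula P .K} {X : MTStructure P .DL} :
      DisplayDerivable L X (.box (.form α)) → DisplayDerivable L X (.form (.box α))
  -- characteristic rules of the extensions; D.AP and D.WS extend D.DP
  | rule_LQM (hL : L = .LQM) {X Y : MTStructure P .DL} :
      DisplayDerivable L X Y → DisplayDerivable L X (.box (.circ Y))
  | rule_UQM (hL : L = .UQM) {X Y : MTStructure P .DL} :
      DisplayDerivable L (.bulL (.dia X)) Y → DisplayDerivable L X Y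
  | res_B (hL : L = .DP ∨ L = .AP ∨ L = .WS) {Γ Δ Θ : MTStructure P .K} :
      DisplayDerivable L (.cap Γ Δ) Θ → DisplayDerivable L Δ (.cup (.star Γ) Θ)
  | res_B' (hL : L = .DP ∨ L = .AP ∨ L = .WS) {Γ Δ Θ : MTStructure P .K} :
      DisplayDerivable L Δ (.cup (.star Γ) Θ) → DisplayDerivable L (.cap Γ Δ) Θ
  | rule_AP (hL : L = .AP) {X Y : MTStructure P .DL} :
      DisplayDerivable L X (.box (.star (.circ Y))) → DisplayDerivable L (.and X Y) .bot
  | rule_WS (hL : L = .WS) {X : MTStructure P .DL} {Δ : MTStructure P .K} :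
      DisplayDerivable L (.dia X) Δ →
        DisplayDerivable L (.dia (.coimp (.box (.star (.circ X))) .top)) Δ

/-!
The proof is semantic: the display calculus `D.L` is sound in a class of two-sorted algebras, and
one algebra of this class, built from the logic `L` itself, refutes every translated sequent that
`L` does not derive.

*Soundness.* A `HetAlgebra` consists of two bi-Heyting algebras `D` and `K` with a map `∘ : D → K`
that has both adjoints, a map `□ : K → D` that has a left adjoint and satisfies `∘ □ = id` and
`□ ⊥ = ⊥`, and an antitone involution of `K`. Residuals and adjoints interpret the structural connectives
that have no counterpart among formulas, so every rule of `D.SM` is an adjunction or an inequality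
valid in these algebras. The characteristic rules correspond to the conditions of
`HetAlgebra.Validates` (`HetAlgebra.interp_le_interp`).

*The canonical algebra.* Besides the entailment `A ⊢ B` of `L`, the relation `A ⊢ₖ B :⇔ ¬¬A ⊢ ¬¬B`
is a distributive lattice preorder on formulas, and for it `¬` is a De Morgan negation; it presents
the kernel `{¬¬a}` of the Lindenbaum algebra of `L` without a quotient. Take for `D` and `K` the
algebras of sets, closed under enlarging a filter, of prime filters of `⊢` and of `⊢ₖ`. A prime
filter of `⊢ₖ` is one of `⊢`, and restriction along this inclusion is `∘`. The relation
`x R y :⇔ {A | ¬¬A ∈ x} ⊆ y` defines `□`, and the map `y ↦ {A | ¬A ∉ y}` defines the involution. Each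
characteristic axiom of `L` yields the matching condition on this algebra
(`canonicalAlgebra_validates`); for `UQM` and `AP` the required prime filter comes from the prime
filter theorem `IsFilter.exists_primeFilter`.

*Truth lemma.* The interpretation of `A.tau` is the set of prime filters that contain `A`
(`mem_canonicalTruth`). For negation this says that `¬A ∈ x` if and only if `¬A ∈ y` for every `y`
with `x R y`, which follows from the equivalence of `¬A` and `¬¬¬A` and the prime filter theorem.
If `A ⊬ B`, some prime filter contains `A` and not `B`, so `A.tau ⊢ B.tau` fails in the canonical algebra.
-/

universe u v

/-! ### Heterogeneous algebras and soundness -/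

/-- The two-sorted algebras that interpret the display calculi. The operations `bulL`, `bulR` and
`dia` are the adjoints that the structural connectives `•_ℓ`, `•_r` and `◆` stand for. -/
structure HetAlgebra (D K : Type u) [BiheytingAlgebra D] [BiheytingAlgebra K] where
  circ : D → K
  bulL : K → D
  bulR : K → D
  box : K → D
  dia : D → K
  star : K → K
  gc_bulL : GaloisConnection bulL circ
  gc_bulR : GaloisConnection circ bulR
  gc_dia : GaloisConnection dia box
  star_antitone : Antitone star
  star_star (a : K) : star (star a) = a
  circ_box (a : K) : circ (box a) = a
  box_bot : box ⊥ = ⊥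

/-- The algebra in which terms of type `t` take their values. -/
def MTType.Carrier (D K : Type u) : MTType → Type u
  | .DL => D
  | .K => K

instance MTType.Carrier.instPreorder (D K : Type u) [BiheytingAlgebra D] [BiheytingAlgebra K] :
    (t : MTType) → Preorder (t.Carrier D K)
  | .DL => inferInstanceAs (Preorder D)
  | .K => inferInstanceAs (Preorder K)

namespace HetAlgebra

variable {P : Type v} {D K : Type u} [BiheytingAlgebra D] [BiheytingAlgebra K]

/-- The interpretation of formulas under a valuation of the propositional variables. -/
def interpForm (H : HetAlgebra D K) (val : P → D) : {t : MTType} → MTFormula P t → t.Carrier D K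
  | _, .var p => val p
  | _, .box α => H.box (H.interpForm val α)
  | _, .top => (⊤ : D)
  | _, .bot => (⊥ : D)
  | _, .and A B => ((H.interpForm val A : D) ⊓ (H.interpForm val B : D) : D)
  | _, .or A B => ((H.interpForm val A : D) ⊔ (H.interpForm val B : D) : D)
  | _, .circ A => H.circ (H.interpForm val A)
  | _, .one => (⊤ : K)
  | _, .zero => (⊥ : K)
  | _, .sim α => H.star (H.interpForm val α)
  | _, .cup α β => ((H.interpForm val α : K) ⊔ (H.interpForm val β : K) : K)
  | _, .cap α β => ((H.interpForm val α : K) ⊓ (H.interpForm val β : K) : K)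

/-- The interpretation of structures. The co-implication `X >- Y` is the difference `Y \ X`. -/
def interp (H : HetAlgebra D K) (val : P → D) : {t : MTType} → MTStructure P t → t.Carrier D K
  | _, .form A => H.interpForm val A
  | _, .top => (⊤ : D)
  | _, .bot => (⊥ : D)
  | _, .box Γ => H.box (H.interp val Γ)
  | _, .bulL Γ => H.bulL (H.interp val Γ)
  | _, .bulR Γ => H.bulR (H.interp val Γ)
  | _, .and X Y => ((H.interp val X : D) ⊓ (H.interp val Y : D) : D)
  | _, .or X Y => ((H.interp val X : D) ⊔ (H.interp val Y : D) : D)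
  | _, .coimp X Y => ((H.interp val Y : D) \ (H.interp val X : D) : D)
  | _, .imp X Y => ((H.interp val X : D) ⇨ (H.interp val Y : D) : D)
  | _, .one => (⊤ : K)
  | _, .zero => (⊥ : K)
  | _, .circ X => H.circ (H.interp val X)
  | _, .dia X => H.dia (H.interp val X)
  | _, .star Γ => H.star (H.interp val Γ)
  | _, .cap Γ Δ => ((H.interp val Γ : K) ⊓ (H.interp val Δ : K) : K)
  | _, .cup Γ Δ => ((H.interp val Γ : K) ⊔ (H.interp val Δ : K) : K)
  | _, .kcoimp Γ Δ => ((H.interp val Δ : K) \ (H.interp val Γ : K) : K)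
  | _, .kimp Γ Δ => ((H.interp val Γ : K) ⇨ (H.interp val Δ : K) : K)

/-- The conditions on an algebra that correspond to the characteristic rules of `D.L`. -/
structure Validates (H : HetAlgebra D K) (L : SMLogic) : Prop where
  le_box_circ : L = .LQM → ∀ a, a ≤ H.box (H.circ a)
  box_circ_le : L = .UQM → ∀ a, H.box (H.circ a) ≤ a
  inf_star : L = .DP ∨ L = .AP ∨ L = .WS → ∀ a, a ⊓ H.star a ≤ ⊥
  inf_box_star_circ : L = .AP → ∀ a, a ⊓ H.box (H.star (H.circ a)) ≤ ⊥
  box_star_circ_sup : L = .WS → ∀ a, ⊤ ≤ H.box (H.star (H.circ a)) ⊔ H.box (H.circ a)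

lemma star_le_comm (H : HetAlgebra D K) {a b : K} (h : H.star a ≤ b) : H.star b ≤ a := by
  simpa only [H.star_star] using H.star_antitone h

lemma le_star_comm (H : HetAlgebra D K) {a b : K} (h : a ≤ H.star b) : b ≤ H.star a := by
  simpa only [H.star_star] using H.star_antitone h

lemma star_le_star_iff (H : HetAlgebra D K) {a b : K} : H.star a ≤ H.star b ↔ b ≤ a :=
  ⟨fun h => by simpa only [H.star_star] using H.star_antitone h, fun h => H.star_antitone h⟩

/-- If `star a` is disjoint from `a` for every `a`, then it is always the complement of `a`: the
involution carries disjointness to the dual statement. -/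
lemma isCompl_star (H : HetAlgebra D K) (h : ∀ a, a ⊓ H.star a ≤ ⊥) (a : K) :
    IsCompl a (H.star a) := by
  refine IsCompl.of_le (h a) ?_
  have h₁ : H.star (a ⊔ H.star a) ≤ ⊥ :=
    le_trans (le_inf (H.star_le_comm le_sup_right) (H.star_antitone le_sup_left)) (h a)
  have h₂ : ⊤ ≤ H.star ⊥ := H.le_star_comm bot_le
  exact le_trans h₂ (H.star_le_comm h₁)

/-- Soundness: the display calculus `D.L` is sound in every algebra that validates `L`. -/
theorem interp_le_interp (H : HetAlgebra D K) {L : SMLogic} (hH : H.Validates L) (val : P → D)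
    {t : MTType} {X Y : MTStructure P t} (h : DisplayDerivable L X Y) :
    H.interp val X ≤ H.interp val Y := by
  induction h with
  | id p => exact le_refl (α := D) _
  | cut_L _ _ ih₁ ih₂ => exact le_trans (α := D) ih₁ ih₂
  | cut_D _ _ ih₁ ih₂ => exact le_trans (α := K) ih₁ ih₂
  | res_and _ ih => exact (le_himp_iff' (α := D)).2 ih
  | res_and' _ ih => exact (le_himp_iff' (α := D)).1 ih
  | res_or _ ih => exact (sdiff_le_iff (α := D)).2 ih
  | res_or' _ ih => exact (sdiff_le_iff (α := D)).1 ih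
  | res_cap _ ih => exact (le_himp_iff' (α := K)).2 ih
  | res_cap' _ ih => exact (le_himp_iff' (α := K)).1 ih
  | res_cup _ ih => exact (sdiff_le_iff (α := K)).2 ih
  | res_cup' _ ih => exact (sdiff_le_iff (α := K)).1 ih
  | adj_star_left _ ih => exact H.star_le_comm ih
  | adj_star_right _ ih => exact H.le_star_comm ih
  | adj_box _ ih => exact (H.gc_dia _ _).2 ih
  | adj_box' _ ih => exact (H.gc_dia _ _).1 ih
  | adj_circ_left _ ih => exact (H.gc_bulR _ _).1 ih
  | adj_circ_left' _ ih => exact (H.gc_bulR _ _).2 ih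
  | adj_circ_right _ ih => exact (H.gc_bulL _ _).2 ih
  | adj_circ_right' _ ih => exact (H.gc_bulL _ _).1 ih
  | top_unit _ ih => exact le_trans (α := D) inf_le_left ih
  | top_unit' _ ih => exact le_trans (α := D) (le_inf le_rfl le_top) ih
  | bot_unit _ ih => exact le_trans (α := D) ih le_sup_left
  | bot_unit' _ ih => exact le_trans (α := D) ih (sup_le le_rfl bot_le)
  | exch_and _ ih => exact le_trans (α := D) (inf_comm _ _).le ih
  | exch_or _ ih => exact le_trans (α := D) ih (sup_comm _ _).le
  | assoc_and _ ih => exact le_trans (α := D) (inf_assoc _ _ _).ge ih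
  | assoc_and' _ ih => exact le_trans (α := D) (inf_assoc _ _ _).le ih
  | assoc_or _ ih => exact le_trans (α := D) ih (sup_assoc _ _ _).le
  | assoc_or' _ ih => exact le_trans (α := D) ih (sup_assoc _ _ _).ge
  | weak_and _ _ ih => exact le_trans (α := D) inf_le_left ih
  | weak_or _ _ ih => exact le_trans (α := D) ih le_sup_left
  | contr_and _ ih => exact le_trans (α := D) (le_inf le_rfl le_rfl) ih
  | contr_or _ ih => exact le_trans (α := D) ih (sup_le le_rfl le_rfl)
  | one_unit _ ih => exact le_trans (α := K) inf_le_left ih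
  | one_unit' _ ih => exact le_trans (α := K) (le_inf le_rfl le_top) ih
  | zero_unit _ ih => exact le_trans (α := K) ih le_sup_left
  | zero_unit' _ ih => exact le_trans (α := K) ih (sup_le le_rfl bot_le)
  | exch_cap _ ih => exact le_trans (α := K) (inf_comm _ _).le ih
  | exch_cup _ ih => exact le_trans (α := K) ih (sup_comm _ _).le
  | assoc_cap _ ih => exact le_trans (α := K) (inf_assoc _ _ _).ge ih
  | assoc_cap' _ ih => exact le_trans (α := K) (inf_assoc _ _ _).le ih
  | assoc_cup _ ih => exact le_trans (α := K) ih (sup_assoc _ _ _).le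
  | assoc_cup' _ ih => exact le_trans (α := K) ih (sup_assoc _ _ _).ge
  | weak_cap _ _ ih => exact le_trans (α := K) inf_le_left ih
  | weak_cup _ _ ih => exact le_trans (α := K) ih le_sup_left
  | contr_cap _ ih => exact le_trans (α := K) (le_inf le_rfl le_rfl) ih
  | contr_cup _ ih => exact le_trans (α := K) ih (sup_le le_rfl le_rfl)
  | cont _ ih => exact H.star_le_star_iff.2 ih
  | cont' _ ih => exact H.star_le_star_iff.1 ih
  | circ_mono _ ih => exact H.gc_bulR.monotone_l ih
  | bul _ ih => exact le_trans (α := K) (H.gc_bulL.le_u_l _) ((H.gc_bulR _ _).2 ih)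
  | dia_one _ ih => exact le_trans (α := K) le_top ih
  | box_zero _ ih => exact le_trans (α := D) ih H.box_bot.le
  | circ_box _ ih => exact le_trans (α := K) ih (H.circ_box _).le
  | circ_box' _ ih => exact le_trans (α := K) ih (H.circ_box _).ge
  | top_left _ ih => exact ih
  | top_right => exact le_refl (α := D) _
  | bot_left => exact le_refl (α := D) _
  | bot_right _ ih => exact ih
  | and_left _ ih => exact ih
  | and_right _ _ ih₁ ih₂ => exact inf_le_inf (α := D) ih₁ ih₂
  | or_left _ _ ih₁ ih₂ => exact sup_le_sup (α := D) ih₁ ih₂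
  | or_right _ ih => exact ih
  | one_left _ ih => exact ih
  | one_right => exact le_refl (α := K) _
  | zero_left => exact le_refl (α := K) _
  | zero_right _ ih => exact ih
  | cap_left _ ih => exact ih
  | cap_right _ _ ih₁ ih₂ => exact inf_le_inf (α := K) ih₁ ih₂
  | cup_left _ _ ih₁ ih₂ => exact sup_le_sup (α := K) ih₁ ih₂
  | cup_right _ ih => exact ih
  | sim_left _ ih => exact ih
  | sim_right _ ih => exact ih
  | circ_left _ ih => exact ih
  | circ_right _ ih => exact ih
  | box_left _ ih => exact H.gc_dia.monotone_u ih
  | box_right _ ih => exact ih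
  | rule_LQM hL _ ih => exact le_trans (α := D) ih (hH.le_box_circ hL _)
  | rule_UQM hL _ ih =>
    exact le_trans (α := D) ((H.gc_dia _ _).1 ((H.gc_bulL _ _).1 ih)) (hH.box_circ_le hL _)
  | res_B hL _ ih =>
    exact le_trans (α := K) ((H.isCompl_star (hH.inf_star hL) _).le_sup_right_iff_inf_left_le.2
      (le_trans (α := K) (inf_comm _ _).le ih)) (sup_comm _ _).le
  | res_B' hL _ ih =>
    exact le_trans (α := K) (inf_comm _ _).le
      ((H.isCompl_star (hH.inf_star hL) _).le_sup_right_iff_inf_left_le.1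
        (le_trans (α := K) ih (sup_comm _ _).le))
  | rule_AP hL _ ih =>
    exact le_trans (α := D) (le_inf inf_le_right (le_trans inf_le_left ih))
      (hH.inf_box_star_circ hL _)
  | rule_WS hL _ ih =>
    -- Since `∘ □ = id`, the premise `X ≤ □Δ` gives `□∘X ≤ □Δ`.
    refine (H.gc_dia _ _).2 ((sdiff_le_iff (α := D)).2
      (le_trans (hH.box_star_circ_sup hL _) (sup_le_sup le_rfl ?_)))
    exact H.gc_dia.monotone_u (le_trans (H.gc_bulR.monotone_l ((H.gc_dia _ _).1 ih))
      (H.circ_box _).le)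

end HetAlgebra

/-! ### Prime filters of formulas -/

section PrimeFilter

variable {P : Type v} {r : SMFormula P → SMFormula P → Prop}

/-- The relation `r` is a preorder on formulas for which `and`, `or`, `top` and `bot` are the
operations of a bounded distributive lattice. -/
structure IsDistribEntailment (r : SMFormula P → SMFormula P → Prop) : Prop where
  refl (A : SMFormula P) : r A A
  trans {A B C : SMFormula P} : r A B → r B C → r A C
  bot_left (A : SMFormula P) : r .bot A
  top_right (A : SMFormula P) : r A .top
  and_left₁ (A B : SMFormula P) : r (.and A B) A
  and_left₂ (A B : SMFormula P) : r (.and A B) B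
  and_right {A B C : SMFormula P} : r A B → r A C → r A (.and B C)
  or_right₁ (A B : SMFormula P) : r A (.or A B)
  or_right₂ (A B : SMFormula P) : r B (.or A B)
  or_left {A B C : SMFormula P} : r A B → r C B → r (.or A C) B
  distrib (A B C : SMFormula P) : r (.and A (.or B C)) (.or (.and A B) (.and A C))

/-- Filters of an entailment relation, not necessarily proper. -/
structure IsFilter (r : SMFormula P → SMFormula P → Prop) (F : Set (SMFormula P)) : Prop where
  top_mem : .top ∈ F
  mem_of_rel {A B : SMFormula P} : r A B → A ∈ F → B ∈ F
  and_mem {A B : SMFormula P} : A ∈ F → B ∈ F → .and A B ∈ F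

/-- Prime filters of an entailment relation. -/
structure PrimeFilter (r : SMFormula P → SMFormula P → Prop) where
  carrier : Set (SMFormula P)
  isFilter : IsFilter r carrier
  bot_notMem : .bot ∉ carrier
  mem_or_mem {A B : SMFormula P} : .or A B ∈ carrier → A ∈ carrier ∨ B ∈ carrier

namespace PrimeFilter

instance : Membership (SMFormula P) (PrimeFilter r) := ⟨fun x A => A ∈ x.carrier⟩

/-- Prime filters are ordered by reverse inclusion, so that the sets of prime filters closed under
enlarging a filter are the lower sets, which Mathlib orders by inclusion. -/
instance : PartialOrder (PrimeFilter r) where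
  le x y := ∀ A, A ∈ y → A ∈ x
  le_refl _ _ h := h
  le_trans _ _ _ h₁ h₂ A h := h₁ A (h₂ A h)
  le_antisymm x y h₁ h₂ := by
    cases x; cases y
    congr 1
    exact Set.ext fun A => ⟨h₂ A, h₁ A⟩

lemma mem_of_rel (x : PrimeFilter r) {A B : SMFormula P} (h : r A B) (hA : A ∈ x) : B ∈ x :=
  x.isFilter.mem_of_rel h hA

lemma top_mem (x : PrimeFilter r) : .top ∈ x := x.isFilter.top_mem

lemma and_mem (x : PrimeFilter r) {A B : SMFormula P} (hA : A ∈ x) (hB : B ∈ x) : .and A B ∈ x :=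
  x.isFilter.and_mem hA hB

lemma and_mem_iff (hr : IsDistribEntailment r) (x : PrimeFilter r) {A B : SMFormula P} :
    .and A B ∈ x ↔ A ∈ x ∧ B ∈ x :=
  ⟨fun h => ⟨x.mem_of_rel (hr.and_left₁ A B) h, x.mem_of_rel (hr.and_left₂ A B) h⟩,
    fun h => x.and_mem h.1 h.2⟩

lemma or_mem_iff (hr : IsDistribEntailment r) (x : PrimeFilter r) {A B : SMFormula P} :
    .or A B ∈ x ↔ A ∈ x ∨ B ∈ x :=
  ⟨x.mem_or_mem, fun h =>
    h.elim (x.mem_of_rel (hr.or_right₁ A B)) (x.mem_of_rel (hr.or_right₂ A B))⟩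

end PrimeFilter

/-- The filter generated by a filter and one more formula. -/
lemma IsFilter.adjoin (hr : IsDistribEntailment r) {F : Set (SMFormula P)} (hF : IsFilter r F)
    (A : SMFormula P) : IsFilter r {C | ∃ B ∈ F, r (.and B A) C} where
  top_mem := ⟨.top, hF.top_mem, hr.top_right _⟩
  mem_of_rel := fun h ⟨B, hB, hBA⟩ => ⟨B, hB, hr.trans hBA h⟩
  and_mem := by
    rintro C₁ C₂ ⟨B₁, hB₁, h₁⟩ ⟨B₂, hB₂, h₂⟩
    refine ⟨.and B₁ B₂, hF.and_mem hB₁ hB₂, hr.and_right (hr.trans ?_ h₁) (hr.trans ?_ h₂)⟩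
    · exact hr.and_right (hr.trans (hr.and_left₁ _ _) (hr.and_left₁ _ _)) (hr.and_left₂ _ _)
    · exact hr.and_right (hr.trans (hr.and_left₁ _ _) (hr.and_left₂ _ _)) (hr.and_left₂ _ _)

/-- The prime filter theorem. The set `I` to be avoided need not be closed downwards, since no
filter that avoids `I` meets its downward closure. -/
theorem IsFilter.exists_primeFilter (hr : IsDistribEntailment r) {F I : Set (SMFormula P)}
    (hF : IsFilter r F) (hbot : .bot ∈ I) (hor : ∀ A ∈ I, ∀ B ∈ I, .or A B ∈ I)
    (hFI : ∀ A ∈ F, A ∉ I) : ∃ x : PrimeFilter r, (∀ A ∈ F, A ∈ x) ∧ ∀ A ∈ I, A ∉ x := by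
  obtain ⟨M, hFM, hM⟩ := zorn_subset_nonempty {G | IsFilter r G ∧ ∀ A ∈ G, A ∉ I} (by
    intro c hc hchain ⟨G₀, hG₀⟩
    refine ⟨⋃₀ c, ⟨⟨⟨G₀, hG₀, (hc hG₀).1.top_mem⟩, ?_, ?_⟩, ?_⟩,
      fun G hG => Set.subset_sUnion_of_mem hG⟩
    · rintro A B h ⟨G, hG, hA⟩
      exact ⟨G, hG, (hc hG).1.mem_of_rel h hA⟩
    · rintro A B ⟨G, hG, hA⟩ ⟨G', hG', hB⟩
      rcases hchain.total hG hG' with h | h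
      · exact ⟨G', hG', (hc hG').1.and_mem (h hA) hB⟩
      · exact ⟨G, hG, (hc hG).1.and_mem hA (h hB)⟩
    · rintro A ⟨G, hG, hA⟩
      exact (hc hG).2 A hA) F ⟨hF, hFI⟩
  obtain ⟨hMF, hMI⟩ := hM.prop
  have key : ∀ A, A ∉ M → ∃ B ∈ M, ∃ C ∈ I, r (.and B A) C := by
    intro A hA
    by_contra! hcon
    -- Otherwise the filter generated by `M` and `A` avoids `I`, against maximality of `M`.
    refine hA (hM.le_of_ge (y := {C | ∃ B ∈ M, r (.and B A) C})
      ⟨hMF.adjoin hr A, fun C ⟨B, hB, hC⟩ hCI => hcon B hB C hCI hC⟩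
      (fun B hB => ⟨B, hB, hr.and_left₁ _ _⟩) ⟨.top, hMF.top_mem, hr.and_left₂ _ _⟩)
  refine ⟨⟨M, hMF, fun h => hMI _ h hbot, ?_⟩, fun A hA => hFM hA, fun A hA h => hMI A h hA⟩
  intro A B hAB
  by_contra! hcon
  obtain ⟨B₁, hB₁, C₁, hC₁, h₁⟩ := key A hcon.1
  obtain ⟨B₂, hB₂, C₂, hC₂, h₂⟩ := key B hcon.2
  refine hMI (.or C₁ C₂) (hMF.mem_of_rel ?_ (hMF.and_mem (hMF.and_mem hB₁ hB₂) hAB))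
    (hor _ hC₁ _ hC₂)
  refine hr.trans (hr.distrib _ _ _) (hr.or_left ?_ ?_)
  · refine hr.trans (hr.trans ?_ h₁) (hr.or_right₁ _ _)
    exact hr.and_right (hr.trans (hr.and_left₁ _ _) (hr.and_left₁ _ _)) (hr.and_left₂ _ _)
  · refine hr.trans (hr.trans ?_ h₂) (hr.or_right₂ _ _)
    exact hr.and_right (hr.trans (hr.and_left₁ _ _) (hr.and_left₂ _ _)) (hr.and_left₂ _ _)

lemma IsFilter.exists_primeFilter_notMem (hr : IsDistribEntailment r) {F : Set (SMFormula P)}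
    (hF : IsFilter r F) {B : SMFormula P} (hB : B ∉ F) :
    ∃ x : PrimeFilter r, (∀ A ∈ F, A ∈ x) ∧ B ∉ x := by
  obtain ⟨x, hx, hxB⟩ := hF.exists_primeFilter hr (I := {C | r C B}) (hr.bot_left B)
    (fun _ h₁ _ h₂ => hr.or_left h₁ h₂) (fun A hA hAB => hB (hF.mem_of_rel hAB hA))
  exact ⟨x, hx, hxB B (hr.refl B)⟩

end PrimeFilter

/-! ### The two entailment relations of a logic -/

namespace SMLogic

variable {P : Type v} (L : SMLogic)

/-- The entailment `¬¬A ⊢ ¬¬B`, which is the order of the kernel `{¬¬a}` of the Lindenbaum algebra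
pulled back along `a ↦ ¬¬a`. -/
def KProvable (A B : SMFormula P) : Prop := L.Provable (.neg (.neg A)) (.neg (.neg B))

variable {L}

lemma Provable.toKProvable {A B : SMFormula P} (h : L.Provable A B) : L.KProvable A B :=
  h.contra.contra

lemma provable_isDistribEntailment : IsDistribEntailment (L.Provable (P := P)) where
  refl := .refl
  trans := .trans
  bot_left := .bot_left
  top_right := .top_right
  and_left₁ := .and_left₁
  and_left₂ := .and_left₂
  and_right := .and_right
  or_right₁ := .or_right₁
  or_right₂ := .or_right₂
  or_left := .or_left
  distrib := .distrib

lemma kProvable_isDistribEntailment : IsDistribEntailment (L.KProvable (P := P)) where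
  refl _ := .refl _
  trans := .trans
  bot_left A := (Provable.bot_left A).toKProvable
  top_right A := (Provable.top_right A).toKProvable
  and_left₁ A B := (Provable.and_left₁ A B).toKProvable
  and_left₂ A B := (Provable.and_left₂ A B).toKProvable
  and_right h₁ h₂ := (Provable.and_right h₁ h₂).trans (.double_neg_and _ _)
  or_right₁ A B := (Provable.or_right₁ A B).toKProvable
  or_right₂ A B := (Provable.or_right₂ A B).toKProvable
  or_left {A B C} h₁ h₂ := by
    have neg_le : ∀ {D : SMFormula P}, L.KProvable D B → L.Provable (.neg B) (.neg D) := fun h =>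
      ((Provable.neg_to_triple _).trans h.contra).trans (.triple_to_neg _)
    exact ((Provable.and_right (neg_le h₁) (neg_le h₂)).trans (.neg_and_neg _ _)).contra
  distrib A B C := (Provable.distrib A B C).toKProvable

lemma kProvable_neg_neg (A : SMFormula P) : L.KProvable (.neg (.neg A)) A :=
  .triple_to_neg _

lemma kProvable_to_neg_neg (A : SMFormula P) : L.KProvable A (.neg (.neg A)) :=
  .neg_to_triple _

lemma KProvable.contra {A B : SMFormula P} (h : L.KProvable A B) :
    L.KProvable (.neg B) (.neg A) :=
  Provable.contra h

lemma kProvable_neg_and (A B : SMFormula P) :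
    L.KProvable (.neg (.and A B)) (.or (.neg A) (.neg B)) := by
  have h : L.Provable (.neg (.or (.neg A) (.neg B))) (.neg (.neg (.and A B))) :=
    (Provable.and_right (Provable.or_right₁ _ _).contra (Provable.or_right₂ _ _).contra).trans
      (.double_neg_and A B)
  exact h.contra

/-- In each of the logics `DP`, `AP` and `WS`, negations satisfy the law of non-contradiction. -/
lemma Provable.neg_and_neg_neg (hL : L = .DP ∨ L = .AP ∨ L = .WS) (A : SMFormula P) :
    L.Provable (.and (.neg A) (.neg (.neg A))) .bot := by
  rcases hL with hL | hL | hL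
  · exact .ax_DP hL A
  · exact .ax_AP hL (.neg A)
  · refine .trans ?_ ((Provable.ax_WS hL A).contra.trans .neg_top)
    refine .trans (.and_right (.and_left₂ _ _) (.trans (.and_left₁ _ _) (.neg_to_triple A))) ?_
    exact .neg_and_neg _ _

end SMLogic

/-! ### The canonical frame -/

section Canonical

variable {P : Type v} {L : SMLogic}

open SMLogic

namespace PrimeFilter

/-- A prime filter of `⊢ₖ`, seen as a prime filter of `⊢`. -/
def toProvable (y : PrimeFilter (L.KProvable (P := P))) : PrimeFilter (L.Provable (P := P)) where
  carrier := y.carrier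
  isFilter := ⟨y.top_mem, fun h => y.mem_of_rel h.toKProvable, y.and_mem⟩
  bot_notMem := y.bot_notMem
  mem_or_mem := y.mem_or_mem

lemma mem_toProvable {y : PrimeFilter (L.KProvable (P := P))} {A : SMFormula P} :
    A ∈ y.toProvable ↔ A ∈ y :=
  Iff.rfl

lemma toProvable_mono : Monotone (toProvable (P := P) (L := L)) := fun _ _ h => h

lemma neg_neg_mem_iff (y : PrimeFilter (L.KProvable (P := P))) {A : SMFormula P} :
    .neg (.neg A) ∈ y ↔ A ∈ y :=
  ⟨y.mem_of_rel (kProvable_neg_neg A), y.mem_of_rel (kProvable_to_neg_neg A)⟩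

/-- The set of formulas whose negation is not in `y`. -/
def dual (y : PrimeFilter (L.KProvable (P := P))) : PrimeFilter (L.KProvable (P := P)) where
  carrier := {A | .neg A ∉ y}
  isFilter := by
    refine ⟨fun h => ?_, fun h hA hB => hA (y.mem_of_rel h.contra hB), fun hA hB hAB => ?_⟩
    · exact y.bot_notMem (y.mem_of_rel Provable.neg_top.toKProvable h)
    · exact (y.mem_or_mem (y.mem_of_rel (kProvable_neg_and _ _) hAB)).elim hA hB
  bot_notMem h := h (y.mem_of_rel Provable.neg_bot.toKProvable y.top_mem)
  mem_or_mem {A B} h := by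
    by_contra! hcon
    obtain ⟨hA, hB⟩ := hcon
    exact h (y.mem_of_rel (Provable.neg_and_neg A B).toKProvable
      (y.and_mem (not_not.1 hA) (not_not.1 hB)))

lemma mem_dual {y : PrimeFilter (L.KProvable (P := P))} {A : SMFormula P} :
    A ∈ y.dual ↔ .neg A ∉ y :=
  Iff.rfl

lemma dual_dual (y : PrimeFilter (L.KProvable (P := P))) : y.dual.dual = y := by
  have h : ∀ A, A ∈ y.dual.dual ↔ A ∈ y := fun A => by
    rw [mem_dual, mem_dual, not_not, neg_neg_mem_iff]
  exact le_antisymm (fun A => (h A).2) (fun A => (h A).1)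

lemma dual_antitone : Antitone (dual (P := P) (L := L)) := fun _ _ h _ hA hA' => hA (h _ hA')

/-- The accessibility relation of `□`: the formulas that the kernel map `A ↦ ¬¬A` sends into `x`
belong to `y`. -/
def Rel (x : PrimeFilter (L.Provable (P := P))) (y : PrimeFilter (L.KProvable (P := P))) : Prop :=
  ∀ A, .neg (.neg A) ∈ x → A ∈ y

lemma isFilter_neg_neg (x : PrimeFilter (L.Provable (P := P))) :
    IsFilter L.KProvable {A | .neg (.neg A) ∈ x} where
  top_mem := x.mem_of_rel (Provable.neg_bot.trans Provable.neg_top.contra) x.top_mem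
  mem_of_rel h hA := x.mem_of_rel h hA
  and_mem hA hB := x.mem_of_rel (.double_neg_and _ _) (x.and_mem hA hB)

/-- Between prime filters of `⊢ₖ`, the accessibility relation is inclusion; this is the identity
`∘ □ = id` on the side of the frame. -/
lemma rel_toProvable_iff {y z : PrimeFilter (L.KProvable (P := P))} :
    Rel y.toProvable z ↔ z ≤ y :=
  ⟨fun h A hA => h A (y.neg_neg_mem_iff.2 hA), fun h A hA => h A (y.neg_neg_mem_iff.1 hA)⟩

lemma exists_rel_notMem (x : PrimeFilter (L.Provable (P := P))) {A : SMFormula P}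
    (h : .neg (.neg A) ∉ x) : ∃ y, Rel x y ∧ A ∉ y :=
  x.isFilter_neg_neg.exists_primeFilter_notMem kProvable_isDistribEntailment h

lemma exists_rel (x : PrimeFilter (L.Provable (P := P))) : ∃ y, Rel x y := by
  obtain ⟨y, hy, -⟩ := x.exists_rel_notMem (A := .bot) fun h =>
    x.bot_notMem (x.mem_of_rel (Provable.neg_bot.contra.trans .neg_top) h)
  exact ⟨y, hy⟩

lemma neg_mem_iff (x : PrimeFilter (L.Provable (P := P))) {A : SMFormula P} :
    .neg A ∈ x ↔ ∀ y, Rel x y → .neg A ∈ y := by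
  refine ⟨fun h y hy => hy _ (x.mem_of_rel (.neg_to_triple A) h), fun h => ?_⟩
  by_contra hA
  obtain ⟨y, hy, hyA⟩ := x.exists_rel_notMem (A := .neg A) fun h' =>
    hA (x.mem_of_rel (.triple_to_neg A) h')
  exact hyA (h y hy)

end PrimeFilter

/-! ### The canonical algebra -/

open PrimeFilter

variable (P L) in
/-- The algebra of lower sets of prime filters, that is, of sets of prime filters closed under
enlarging a filter. -/
def canonicalAlgebra : HetAlgebra (LowerSet (PrimeFilter (L.Provable (P := P))))
    (LowerSet (PrimeFilter (L.KProvable (P := P)))) where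
  circ U := ⟨{y | y.toProvable ∈ U}, fun _ _ h hy => U.lower (toProvable_mono h) hy⟩
  bulL V := ⟨{x | ∃ y ∈ V, x ≤ y.toProvable}, fun _ _ h ⟨y, hy, hxy⟩ => ⟨y, hy, h.trans hxy⟩⟩
  bulR V := ⟨{x | ∀ y, y.toProvable ≤ x → y ∈ V}, fun _ _ h hx y hy => hx y (hy.trans h)⟩
  box V := ⟨{x | ∀ y, Rel x y → y ∈ V}, fun _ _ h hx y hy => hx y fun A hA => hy A (h _ hA)⟩
  dia U := ⟨{y | ∃ x ∈ U, Rel x y}, fun _ _ h ⟨x, hx, hxy⟩ => ⟨x, hx, fun A hA => h A (hxy A hA)⟩⟩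
  star V := ⟨{y | y.dual ∉ V}, fun _ _ h hy hy' => hy (V.lower (dual_antitone h) hy')⟩
  gc_bulL V U := ⟨fun h y hy => h ⟨y, hy, le_rfl⟩, fun h _ ⟨_, hy, hxy⟩ => U.lower hxy (h hy)⟩
  gc_bulR U V := ⟨fun h _ hx _ hy => h (U.lower hy hx), fun h y hy => h hy y le_rfl⟩
  gc_dia U V := ⟨fun h x hx _ hy => h ⟨x, hx, hy⟩, fun h y ⟨_, hx, hxy⟩ => h hx y hxy⟩
  star_antitone _ _ h _ hy hy' := hy (h hy')
  star_star V := by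
    ext y
    change ¬ (¬ y.dual.dual ∈ V) ↔ y ∈ V
    rw [not_not, dual_dual]
  circ_box V := by
    ext y
    exact ⟨fun h => h y (rel_toProvable_iff.2 le_rfl),
      fun h z hz => V.lower (rel_toProvable_iff.1 hz) h⟩
  box_bot := le_bot_iff.1 fun x hx => (exists_rel x).elim fun y hy => hx y hy

theorem canonicalAlgebra_validates : (canonicalAlgebra P L).Validates L where
  le_box_circ hL U x hx y hy := U.lower (fun A hA => hy A (x.mem_of_rel (.ax_LQM hL A) hA)) hx
  box_circ_le hL U x hx := by
    -- A prime filter `y` of `⊢ₖ` accessible from `x` and contained in `x`.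
    obtain ⟨y, hy, hyx⟩ := x.isFilter_neg_neg.exists_primeFilter kProvable_isDistribEntailment
      (I := {A | A ∉ x}) x.bot_notMem (fun _ hA _ hB h => (x.mem_or_mem h).elim hA hB)
      (fun A hA hA' => hA' (x.mem_of_rel (.ax_UQM hL A) hA))
    exact U.lower (fun _ hA => by_contra fun h => hyx _ h hA) (hx y hy)
  inf_star hL V y hy := by
    obtain ⟨hy, hy'⟩ := hy
    refine hy' (V.lower (fun A hA hnA => ?_) hy)
    exact y.bot_notMem (y.mem_of_rel (Provable.neg_and_neg_neg hL A).toKProvable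
      (y.and_mem hnA (y.neg_neg_mem_iff.2 hA)))
  inf_box_star_circ hL U x hx := by
    obtain ⟨hx, hx'⟩ := hx
    -- A prime filter `y` of `⊢ₖ` accessible from `x` whose dual contains `x`.
    obtain ⟨y, hy, hyx⟩ := x.isFilter_neg_neg.exists_primeFilter kProvable_isDistribEntailment
      (I := {C | ∃ A ∈ x, L.KProvable C (.neg A)})
      ⟨.top, x.top_mem, kProvable_isDistribEntailment.bot_left _⟩
      (fun C₁ ⟨A₁, hA₁, h₁⟩ C₂ ⟨A₂, hA₂, h₂⟩ => ⟨.and A₁ A₂, x.and_mem hA₁ hA₂,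
        kProvable_isDistribEntailment.or_left
          (h₁.trans (Provable.and_left₁ A₁ A₂).contra.toKProvable)
          (h₂.trans (Provable.and_left₂ A₁ A₂).contra.toKProvable)⟩)
      (fun C hC ⟨A, hA, hCA⟩ => x.bot_notMem (x.mem_of_rel (.ax_AP hL A)
        (x.and_mem hA (x.mem_of_rel (hCA.trans (.triple_to_neg A)) hC))))
    exact hx' y hy (U.lower
      (fun A hA => hyx (.neg A) ⟨A, hA, kProvable_isDistribEntailment.refl _⟩) hx)
  box_star_circ_sup hL U x _ := by
    by_contra hcon
    obtain ⟨h₁, h₂⟩ := not_or.1 hcon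
    obtain ⟨y, hxy, hy⟩ := not_forall₂.1 h₁
    obtain ⟨z, hxz, hz⟩ := not_forall₂.1 h₂
    refine hz (U.lower (fun A hA => ?_) (not_not.1 hy))
    -- By the axiom, one of `¬A` and `¬¬A` is in `x`, and `¬A ∈ x` would give `¬A ∈ y`.
    refine (x.mem_or_mem (x.mem_of_rel (.ax_WS hL A) x.top_mem)).elim (fun h => ?_) (hxz A)
    exact absurd (x.neg_mem_iff.1 h y hxy) hA

/-! ### The truth lemma and conservativity -/

variable (P L) in
/-- The canonical valuation sends `p` to the set of prime filters that contain `p`. -/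
def canonicalVal (p : P) : LowerSet (PrimeFilter (L.Provable (P := P))) :=
  ⟨{x | .var p ∈ x}, fun _ _ h hx => h _ hx⟩

/-- The set that interprets the translation of `A` in the canonical algebra. -/
def canonicalTruth (L : SMLogic) (A : SMFormula P) :
    LowerSet (PrimeFilter (L.Provable (P := P))) :=
  (canonicalAlgebra P L).interpForm (canonicalVal P L) A.tau

/-- The truth lemma: the translation of `A` holds at `x` exactly if `A ∈ x`. -/
lemma mem_canonicalTruth (A : SMFormula P) (x : PrimeFilter (L.Provable (P := P))) :
    x ∈ canonicalTruth L A ↔ A ∈ x := by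
  induction A generalizing x with
  | var p => exact Iff.rfl
  | top => exact iff_of_true trivial x.top_mem
  | bot => exact iff_of_false id x.bot_notMem
  | neg A ih =>
    rw [x.neg_mem_iff]
    refine forall₂_congr fun y _ => ?_
    change ¬ (y.dual.toProvable ∈ canonicalTruth L A) ↔ _
    rw [ih, mem_toProvable, mem_dual, not_not]
  | and A B ihA ihB =>
    rw [and_mem_iff provable_isDistribEntailment, ← ihA, ← ihB]
    exact Iff.rfl
  | or A B ihA ihB =>
    rw [or_mem_iff provable_isDistribEntailment, ← ihA, ← ihB]
    exact Iff.rfl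

lemma isFilter_provable (A : SMFormula P) : IsFilter L.Provable {B | L.Provable A B} where
  top_mem := .top_right A
  mem_of_rel h hA := hA.trans h
  and_mem := .and_right

end Canonical

theorem mainTheorem2 {Atprop : Type*} [Denumerable Atprop] (L : SMLogic)
    (A B : SMFormula Atprop)
    (h : DisplayDerivable L (.form A.tau) (.form B.tau)) : SMLogic.Provable L A B := by
  by_contra hAB
  obtain ⟨x, hx, hxB⟩ := (isFilter_provable (L := L) A).exists_primeFilter_notMem
    SMLogic.provable_isDistribEntailment hAB
  have hle : canonicalTruth L A ≤ canonicalTruth L B :=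
    (canonicalAlgebra Atprop L).interp_le_interp canonicalAlgebra_validates
      (canonicalVal Atprop L) h
  exact hxB ((mem_canonicalTruth B x).1
    (hle ((mem_canonicalTruth A x).2 (hx A (.refl A)))))
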